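/- Let $(\Omega,\Sigma,\mathbb P)$ be a probability space and let $L_0(\Sigma)$ be the vector lattice of real-valued $\Sigma$-measurable functions modulo a.e. equality, with the a.e. order. Let $X$ be a Banach function space in $L_0(\Sigma)$, i.e. an ideal (a linear subspace such that $|x|\le|y|$ and $y\in X$ imply $x\in X$) which carries a complete lattice norm, and assume that $X$ contains the constant functions. Let $X_n^\sim$ be the space of order continuous linear functionals on $X$, i.e. of those $\varphi$ with $\varphi(x_\alpha)\to0$ for every net $(x_\alpha)$ in $X$ that converges to $0$ in order, and let $\sigma(X,X_n^\sim)$ be the weak topology on $X$ that it induces. Let $f\in X$ with $f\ge 0$, let $M=O_f=\operatorname{span}\{\mathbb 1,(f-k)^+: k\in\mathbb R\}$, and let $\pi:M\to\mathbb R$ be a positive linear functional. Let $M_0=\{x\in M:\pi(x)=0\}$ and $X_+=\{x\in X: x\ge 0\}$, and suppose that $(M,\pi)$ admits no free lunches, i.e. $$\overline{M_0-X_+}^{\,\sigma(X,X_n^\sim)}\cap X_+=\{0\}.$$ Let $\sigma(f)$ be the smallest sub-$\sigma$-algebra of $\Sigma$ that makes $f$ measurable and contains all $\mathbb P$-null sets,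 and let $L_0(\sigma(f))$ be the set of functions in $L_0(\Sigma)$ that are $\sigma(f)$-measurable. Then for every $g\in L_0(\sigma(f))\cap X$ the price of $g$ is determined by arbitrage from $(M,\pi)$: there is exactly one real number $p$ for which there exists a functional $x^*\in X_n^\sim$ that is strictly positive ($x^*(x)>0$ for all $x\in X$ with $x\geq 0$, $x\ne 0$) and satisfies $x^*|_M=\pi$ and $x^*(g)=p$. -/

import Mathlib

open MeasureTheory Filter Topology

universe u

namespace OptionSpanning

/- Throughout, `L₀(Σ)` is Mathlib's `Ω →ₘ[P] ℝ`: measurable functions modulo a.e. equality, with the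
a.e. pointwise order. A function space is a linear subspace `X` of it, with the induced order. -/
variable {Ω : Type u} [MeasurableSpace Ω] {P : Measure Ω}

/-- `X` is an ideal (solid subspace) of `L₀(Σ)`. -/
def IsIdeal (X : Submodule ℝ (Ω →ₘ[P] ℝ)) : Prop :=
  ∀ x y : Ω →ₘ[P] ℝ, |x| ≤ |y| → y ∈ X → x ∈ X

/-- `N` is a complete lattice norm on `X`. -/
structure IsCompleteLatticeNorm (X : Submodule ℝ (Ω →ₘ[P] ℝ)) (N : Seminorm ℝ X) : Prop where
  eq_zero : ∀ x : X, N x = 0 → x = 0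
  mono : ∀ x y : X, |(x : Ω →ₘ[P] ℝ)| ≤ |(y : Ω →ₘ[P] ℝ)| → N x ≤ N y
  complete : ∀ u : ℕ → X,
    (∀ ε : ℝ, 0 < ε → ∃ n₀, ∀ m, n₀ ≤ m → ∀ n, n₀ ≤ n → N (u m - u n) < ε) →
      ∃ a : X, Tendsto (fun n => N (u n - a)) atTop (𝓝 0)

/-- A Banach function space: an ideal of `L₀(Σ)` which carries a complete lattice norm. -/
def IsBanachFunctionSpace (X : Submodule ℝ (Ω →ₘ[P] ℝ)) : Prop :=
  IsIdeal X ∧ ∃ N : Seminorm ℝ X, IsCompleteLatticeNorm X N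

variable {X : Submodule ℝ (Ω →ₘ[P] ℝ)}

/-- `D ↓ 0` in `X`: a nonempty downward directed set with infimum `0` in `X`. -/
def DecreasesToZero (D : Set X) : Prop :=
  D.Nonempty ∧ DirectedOn (· ≥ ·) D ∧ IsGLB D 0

/-- Order convergence in `X` of a net `(x i)` to `a`: there is `D ↓ 0` in `X` (the values of the
dominating net) such that for every `d ∈ D` eventually `|x i - a| ≤ d`. -/
def OrderConverges {ι : Type*} [Preorder ι] (x : ι → X) (a : X) : Prop :=
  ∃ D : Set X, DecreasesToZero D ∧
    ∀ d ∈ D, ∃ i₀, ∀ i, i₀ ≤ i → |((x i - a : X) : Ω →ₘ[P] ℝ)| ≤ (d : Ω →ₘ[P] ℝ)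

/-- A linear functional is order continuous if it maps nets that converge to `0` in order to nets
that converge to `0`. By `isOrderContinuous_iff` below, the choice of the universe of the index
sets does not matter. -/
def IsOrderContinuous (φ : X →ₗ[ℝ] ℝ) : Prop :=
  ∀ (ι : Type u) [Preorder ι] [IsDirectedOrder ι] [Nonempty ι] (x : ι → X),
    OrderConverges x 0 → Tendsto (fun i => φ (x i)) atTop (𝓝 0)

theorem isOrderContinuous_iff (φ : X →ₗ[ℝ] ℝ) :
    IsOrderContinuous φ ↔ ∀ D : Set X, DecreasesToZero D → ∀ ε : ℝ, 0 < ε →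
      ∃ d ∈ D, ∀ x : X, |(x : Ω →ₘ[P] ℝ)| ≤ (d : Ω →ₘ[P] ℝ) → |φ x| < ε := by
  constructor
  · intro h D hD ε hε
    -- the index set: pairs `(d, x)` with `d ∈ D` and `|x| ≤ d`, ordered by decreasing `d`
    obtain ⟨ι, e, -⟩ : ∃ (ι : Type u)
        (_ : ι ≃ {p : X × X // p.1 ∈ D ∧ |(p.2 : Ω →ₘ[P] ℝ)| ≤ (p.1 : Ω →ₘ[P] ℝ)}), True :=
      ⟨_, Equiv.refl _, trivial⟩
    let _ : Preorder ι := Preorder.lift (fun i : ι => OrderDual.toDual (e i).1.1)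
    have hle : ∀ i j : ι, i ≤ j ↔ (e j).1.1 ≤ (e i).1.1 := fun i j => Iff.rfl
    have hidx : ∀ d ∈ D, ∀ x : X, |(x : Ω →ₘ[P] ℝ)| ≤ (d : Ω →ₘ[P] ℝ) →
        ∃ i : ι, (e i).1 = (d, x) := fun d hd x hx =>
      ⟨e.symm ⟨(d, x), hd, hx⟩, by rw [Equiv.apply_symm_apply]⟩
    have hpos : ∀ d ∈ D, ∃ i : ι, (e i).1 = (d, 0) := fun d hd => hidx d hd 0 (by
      have h0 : ((0 : X) : Ω →ₘ[P] ℝ) ≤ (d : Ω →ₘ[P] ℝ) := hD.2.2.1 hd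
      simpa [abs] using h0)
    have _ : Nonempty ι := by
      obtain ⟨d, hd⟩ := hD.1
      exact ⟨(hpos d hd).choose⟩
    have _ : IsDirectedOrder ι := by
      refine ⟨fun i j => ?_⟩
      obtain ⟨d, hd, h1, h2⟩ := hD.2.1 (e i).1.1 (e i).2.1 (e j).1.1 (e j).2.1
      obtain ⟨k, hk⟩ := hpos d hd
      exact ⟨k, (hle i k).2 (by rw [hk]; exact h1), (hle j k).2 (by rw [hk]; exact h2)⟩
    have ht := h ι (fun i => (e i).1.2) ⟨D, hD, fun d hd => by
      obtain ⟨k, hk⟩ := hpos d hd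
      refine ⟨k, fun i hi => ?_⟩
      have h1 : (e i).1.1 ≤ d := by
        have := (hle k i).1 hi
        rwa [hk] at this
      have h2 : ((e i).1.1 : Ω →ₘ[P] ℝ) ≤ (d : Ω →ₘ[P] ℝ) := h1
      rw [sub_zero]
      exact (e i).2.2.trans h2⟩
    obtain ⟨i, hi⟩ := eventually_atTop.1 (Metric.tendsto_nhds.1 ht ε hε)
    refine ⟨(e i).1.1, (e i).2.1, fun x hx => ?_⟩
    obtain ⟨j, hj⟩ := hidx _ (e i).2.1 x hx
    have := hi j ((hle i j).2 (by rw [hj]))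
    rw [hj] at this
    simpa [Real.dist_eq] using this
  · rintro h ι _ _ _ x ⟨D, hD, hx⟩
    refine Metric.tendsto_nhds.2 fun ε hε => ?_
    obtain ⟨d, hd, hφ⟩ := h D hD ε hε
    obtain ⟨i₀, hi⟩ := hx d hd
    refine eventually_atTop.2 ⟨i₀, fun i hii => ?_⟩
    simpa [Real.dist_eq] using hφ (x i) (by simpa using hi i hii)

variable (X) in
/-- The order continuous dual of `X`. -/
def orderContinuousDual : Submodule ℝ (X →ₗ[ℝ] ℝ) where
  carrier := {φ | IsOrderContinuous φ}
  zero_mem' := fun ι _ _ _ x _ => by simp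
  add_mem' := fun {φ ψ} hφ hψ ι _ _ _ x hx => by
    simpa using (hφ ι x hx).add (hψ ι x hx)
  smul_mem' := fun c φ hφ ι _ _ _ x hx => by
    simpa using (hφ ι x hx).const_mul c

variable (X) in
/-- The duality pairing of `X` with its order continuous dual. -/
def pairing : X →ₗ[ℝ] orderContinuousDual X →ₗ[ℝ] ℝ :=
  (orderContinuousDual X).subtype.flip

variable (X) in
/-- The weak topology on `X` induced by its order continuous dual. -/
@[reducible] def sigmaTopology : TopologicalSpace X :=
  inferInstanceAs (TopologicalSpace (WeakBilin (pairing X)))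

/-- The option space of `f`: the linear span in `X` of the constant function `1` and the functions
`(f - k)⁺`, `k ∈ ℝ`. -/
def optionSpace (f : X) : Submodule ℝ X :=
  Submodule.span ℝ {x : X | (x : Ω →ₘ[P] ℝ) = 1 ∨
    ∃ k : ℝ, (x : Ω →ₘ[P] ℝ) = ((f : Ω →ₘ[P] ℝ) - AEEqFun.const Ω k) ⊔ 0}

/-- The smallest sub-`σ`-algebra of `Σ` which makes `f` measurable and contains all null sets
in `Σ`. -/
@[reducible] noncomputable def sigmaAlgebra (f : Ω →ₘ[P] ℝ) : MeasurableSpace Ω :=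
  MeasurableSpace.comap (f : Ω → ℝ) inferInstance ⊔
    MeasurableSpace.generateFrom {A : Set Ω | MeasurableSet A ∧ P A = 0}

/-- `g` is a contingent claim written on `f`: it is measurable with respect to `sigmaAlgebra f`.
Since that `σ`-algebra contains the null sets, the choice of representative is irrelevant. -/
def IsContingentClaimOn (f g : X) : Prop :=
  Measurable[sigmaAlgebra (f : Ω →ₘ[P] ℝ)] ((g : Ω →ₘ[P] ℝ) : Ω → ℝ)

/-- `π` is a positive linear functional on the subspace `M` of `X`. -/
def IsPositiveOn (M : Submodule ℝ X) (π : M →ₗ[ℝ] ℝ) : Prop :=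
  ∀ m : M, 0 ≤ (m : X) → 0 ≤ π m

/-- `(M, π)` admits no free lunches: `C ∩ X₊ = {0}` where `C` is the weak closure of `M₀ - X₊` and
`M₀` is the kernel of `π`. -/
def NoFreeLunch (M : Submodule ℝ X) (π : M →ₗ[ℝ] ℝ) : Prop :=
  closure[sigmaTopology X] {z : X | ∃ m : M, π m = 0 ∧ ∃ y : X, 0 ≤ y ∧ z = (m : X) - y} ∩
    {x : X | 0 ≤ x} = {0}

/-- The price `p` of `g` is consistent with `(M, π)`: some strictly positive order continuous
linear functional on `X` extends `π` and has the value `p` at `g`. -/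
def IsConsistentPrice (M : Submodule ℝ X) (π : M →ₗ[ℝ] ℝ) (g : X) (p : ℝ) : Prop :=
  ∃ φ ∈ orderContinuousDual X, (∀ x : X, 0 < x → 0 < φ x) ∧ (∀ m : M, φ (m : X) = π m) ∧ φ g = p

/-- The price of `g` is determined by arbitrage from `(M, π)`. -/
def IsDeterminedByArbitrage (M : Submodule ℝ X) (π : M →ₗ[ℝ] ℝ) (g : X) : Prop :=
  ∃! p : ℝ, IsConsistentPrice M π g p

end OptionSpanning

namespace OptionSpanning

section

variable {Ω : Type u} [MeasurableSpace Ω] {P : Measure Ω} {X : Submodule ℝ (Ω →ₘ[P] ℝ)}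

/-! Existence of a price is a Kreps-Yan argument, uniqueness a spanning argument. For uniqueness,
the difference θ of two order continuous extensions of π vanishes on the option space. The call
spreads n((f - k)⁺ - (f - k - 1/n)⁺) increase to the indicator of {f > k}, so θ kills these
indicators. A π-λ argument, simple functions and monotone limits then give θ g = 0 for every claim g
written on f (`map_contingentClaim_eq_zero`). For existence, Hahn-Banach gives, for each x > 0, a
positive order continuous φ that vanishes on the kernel of π and has φ x > 0
(`NoFreeLunch.exists_map_pos`). Completeness of the norm makes positive functionals bounded, so
countably many of them can be summed with weights. Exhaustion by measure then yields one that is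
strictly positive (`NoFreeLunch.exists_strictlyPositive`), and a positive multiple of it extends π.
-/

theorem le_iff_ae {x y : X} :
    x ≤ y ↔ ∀ᵐ ω ∂P, (x : Ω →ₘ[P] ℝ) ω ≤ (y : Ω →ₘ[P] ℝ) ω :=
  AEEqFun.coeFn_le.symm

theorem ext_ae {x y : X} (h : ∀ᵐ ω ∂P, (x : Ω →ₘ[P] ℝ) ω = (y : Ω →ₘ[P] ℝ) ω) : x = y :=
  Subtype.ext (AEEqFun.ext h)

theorem coe_zero_ae : ∀ᵐ ω ∂P, ((0 : X) : Ω →ₘ[P] ℝ) ω = 0 :=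
  AEEqFun.coeFn_zero

theorem coe_add_ae (x y : X) : ∀ᵐ ω ∂P,
    ((x + y : X) : Ω →ₘ[P] ℝ) ω = (x : Ω →ₘ[P] ℝ) ω + (y : Ω →ₘ[P] ℝ) ω :=
  AEEqFun.coeFn_add _ _

theorem coe_sub_ae (x y : X) : ∀ᵐ ω ∂P,
    ((x - y : X) : Ω →ₘ[P] ℝ) ω = (x : Ω →ₘ[P] ℝ) ω - (y : Ω →ₘ[P] ℝ) ω :=
  AEEqFun.coeFn_sub _ _

theorem coe_neg_ae (x : X) : ∀ᵐ ω ∂P,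
    ((-x : X) : Ω →ₘ[P] ℝ) ω = -(x : Ω →ₘ[P] ℝ) ω :=
  AEEqFun.coeFn_neg _

theorem coe_smul_ae (c : ℝ) (x : X) : ∀ᵐ ω ∂P,
    ((c • x : X) : Ω →ₘ[P] ℝ) ω = c * (x : Ω →ₘ[P] ℝ) ω :=
  AEEqFun.coeFn_smul _ _

instance : IsOrderedAddMonoid X where
  add_le_add_left x y h z := le_iff_ae.2 <| by
    filter_upwards [le_iff_ae.1 h, coe_add_ae x z, coe_add_ae y z] with ω h1 h2 h3
    rw [h2, h3]
    linarith

theorem nonneg_iff_ae {x : X} : 0 ≤ x ↔ ∀ᵐ ω ∂P, 0 ≤ (x : Ω →ₘ[P] ℝ) ω := by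
  rw [le_iff_ae]
  refine eventually_congr ?_
  filter_upwards [coe_zero_ae (X := X)] with ω h
  rw [h]

theorem abs_le_iff_ae {a b : Ω →ₘ[P] ℝ} : |a| ≤ b ↔ ∀ᵐ ω ∂P, |a ω| ≤ b ω := by
  rw [← AEEqFun.coeFn_le]
  refine eventually_congr ?_
  filter_upwards [AEEqFun.coeFn_abs a] with ω h
  rw [h]

theorem abs_le_abs_iff_ae {a b : Ω →ₘ[P] ℝ} : |a| ≤ |b| ↔ ∀ᵐ ω ∂P, |a ω| ≤ |b ω| := by
  rw [abs_le_iff_ae]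
  refine eventually_congr ?_
  filter_upwards [AEEqFun.coeFn_abs b] with ω h
  rw [h]

/-! ### Functions contained in an ideal -/

theorem abs_max_zero_le_abs (t : ℝ) : |max t 0| ≤ |t| := by
  rcases le_total 0 t with h | h <;> simp [h]

/-- An ideal contains every measurable function dominated by one of its elements. -/
theorem IsIdeal.exists_of_dominated (hX : IsIdeal X) (y : X) {h : Ω → ℝ}
    (hm : AEStronglyMeasurable h P) (hle : ∀ᵐ ω ∂P, |h ω| ≤ |(y : Ω →ₘ[P] ℝ) ω|) :
    ∃ x : X, ∀ᵐ ω ∂P, (x : Ω →ₘ[P] ℝ) ω = h ω := by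
  have hmk := AEEqFun.coeFn_mk h hm
  refine ⟨⟨AEEqFun.mk h hm, hX _ y (abs_le_abs_iff_ae.2 ?_) y.2⟩, hmk⟩
  filter_upwards [hmk, hle] with ω h1 h2
  rwa [h1]

/-- An ideal that contains the constants contains every bounded measurable function. -/
theorem IsIdeal.exists_of_bounded (hX : IsIdeal X) (hone : (1 : Ω →ₘ[P] ℝ) ∈ X) {h : Ω → ℝ}
    (hm : AEStronglyMeasurable h P) {C : ℝ} (hle : ∀ᵐ ω ∂P, |h ω| ≤ C) :
    ∃ x : X, ∀ᵐ ω ∂P, (x : Ω →ₘ[P] ℝ) ω = h ω := by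
  refine hX.exists_of_dominated (C • ⟨1, hone⟩) hm ?_
  filter_upwards [hle, coe_smul_ae C (⟨1, hone⟩ : X),
    (AEEqFun.coeFn_one : ⇑(1 : Ω →ₘ[P] ℝ) =ᵐ[P] 1)] with ω h1 h2 h3
  rw [h2, h3]
  simpa using h1.trans (le_abs_self C)

/-- An ideal that contains the constants contains every indicator function. -/
theorem IsIdeal.exists_indicator (hX : IsIdeal X) (hone : (1 : Ω →ₘ[P] ℝ) ∈ X) {A : Set Ω}
    (hA : MeasurableSet A) :
    ∃ x : X, ∀ᵐ ω ∂P, (x : Ω →ₘ[P] ℝ) ω = A.indicator 1 ω := by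
  refine hX.exists_of_bounded hone (C := 1)
    ((measurable_one.indicator hA).aestronglyMeasurable) (ae_of_all _ fun ω => ?_)
  by_cases h : ω ∈ A <;> simp [h]

/-! ### Order continuity along increasing sequences -/

/-- The differences a - u n decrease to 0 in X: only countably many null sets are involved, so a
lower bound lies below all of them pointwise a.e., hence below their limit 0. This is the form in
which order continuity enters the measure-theoretic arguments. -/
theorem IsOrderContinuous.tendsto_of_monotone {θ : X →ₗ[ℝ] ℝ} (hθ : IsOrderContinuous θ)
    {u : ℕ → X} {a : X} (hu : Monotone u)
    (hlim : ∀ᵐ ω ∂P, Tendsto (fun n => (u n : Ω →ₘ[P] ℝ) ω) atTop (𝓝 ((a : Ω →ₘ[P] ℝ) ω))) :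
    Tendsto (fun n => θ (u n)) atTop (𝓝 (θ a)) := by
  have hmono : ∀ᵐ ω ∂P, Monotone fun n => (u n : Ω →ₘ[P] ℝ) ω := by
    have : ∀ᵐ ω ∂P, ∀ n, (u n : Ω →ₘ[P] ℝ) ω ≤ (u (n + 1) : Ω →ₘ[P] ℝ) ω :=
      ae_all_iff.2 fun n => le_iff_ae.1 (hu n.le_succ)
    filter_upwards [this] with ω h using monotone_nat_of_le_succ h
  have hle : ∀ n, u n ≤ a := fun n => le_iff_ae.2 <| by
    filter_upwards [hmono, hlim] with ω h1 h2 using h1.ge_of_tendsto h2 n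
  have hD : DecreasesToZero (Set.range fun n => a - u n) := by
    refine ⟨Set.range_nonempty _, ?_, ?_, ?_⟩
    · rintro _ ⟨n, rfl⟩ _ ⟨m, rfl⟩
      exact ⟨_, ⟨max n m, rfl⟩, sub_le_sub_left (hu (le_max_left _ _)) _,
        sub_le_sub_left (hu (le_max_right _ _)) _⟩
    · rintro _ ⟨n, rfl⟩
      exact sub_nonneg.2 (hle n)
    · intro l hl
      have h1 : ∀ᵐ ω ∂P, ∀ n, (l : Ω →ₘ[P] ℝ) ω ≤ (a : Ω →ₘ[P] ℝ) ω - (u n : Ω →ₘ[P] ℝ) ω := by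
        refine ae_all_iff.2 fun n => ?_
        filter_upwards [le_iff_ae.1 (hl ⟨n, rfl⟩), coe_sub_ae a (u n)] with ω h1 h2
        rwa [← h2]
      refine le_iff_ae.2 ?_
      filter_upwards [h1, hlim, coe_zero_ae (X := X)] with ω h1 h2 h3
      rw [h3]
      have := h2.const_sub ((a : Ω →ₘ[P] ℝ) ω)
      rw [sub_self] at this
      exact ge_of_tendsto' this h1
  refine Metric.tendsto_atTop.2 fun ε hε => ?_
  obtain ⟨_, ⟨n, rfl⟩, hn⟩ := (isOrderContinuous_iff θ).1 hθ _ hD ε hε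
  refine ⟨n, fun m hm => ?_⟩
  have := hn (u m - a) (abs_le_iff_ae.2 ?_)
  · rwa [map_sub, ← Real.dist_eq] at this
  · filter_upwards [coe_sub_ae (u m) a, coe_sub_ae a (u n), le_iff_ae.1 (hle m),
      le_iff_ae.1 (hu hm)] with ω h1 h2 h3 h4
    rw [h1, h2, abs_le]
    constructor <;> linarith

/-! ### Spanning of claims by options -/

theorem one_mem_optionSpace (hone : (1 : Ω →ₘ[P] ℝ) ∈ X) (f : X) :
    (⟨1, hone⟩ : X) ∈ optionSpace f :=
  Submodule.subset_span (Or.inl rfl)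

theorem coe_one_ae (hone : (1 : Ω →ₘ[P] ℝ) ∈ X) :
    ∀ᵐ ω ∂P, ((⟨1, hone⟩ : X) : Ω →ₘ[P] ℝ) ω = 1 :=
  AEEqFun.coeFn_one

theorem exists_mem_optionSpace (hX : IsIdeal X) (hone : (1 : Ω →ₘ[P] ℝ) ∈ X) (f : X) (k : ℝ) :
    ∃ y ∈ optionSpace f,
      ∀ᵐ ω ∂P, (y : Ω →ₘ[P] ℝ) ω = max ((f : Ω →ₘ[P] ℝ) ω - k) 0 := by
  have h1 : ∀ᵐ ω ∂P, (((f : Ω →ₘ[P] ℝ) - AEEqFun.const Ω k) ⊔ 0 : Ω →ₘ[P] ℝ) ω =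
      max ((f : Ω →ₘ[P] ℝ) ω - k) 0 := by
    filter_upwards [AEEqFun.coeFn_sup ((f : Ω →ₘ[P] ℝ) - AEEqFun.const Ω k) 0,
      AEEqFun.coeFn_sub (f : Ω →ₘ[P] ℝ) (AEEqFun.const Ω k),
      AEEqFun.coeFn_const (μ := P) Ω k,
      (AEEqFun.coeFn_zero : ⇑(0 : Ω →ₘ[P] ℝ) =ᵐ[P] 0)] with ω h1 h2 h3 h4
    rw [h1, h2, Pi.sub_apply, h3, h4]
    rfl
  refine ⟨⟨((f : Ω →ₘ[P] ℝ) - AEEqFun.const Ω k) ⊔ 0,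
    hX _ ((f - k • ⟨1, hone⟩ : X) : Ω →ₘ[P] ℝ) (abs_le_abs_iff_ae.2 ?_) (SetLike.coe_mem _)⟩,
    Submodule.subset_span (Or.inr ⟨k, rfl⟩), h1⟩
  filter_upwards [h1, coe_sub_ae f (k • ⟨1, hone⟩), coe_smul_ae k (⟨1, hone⟩ : X),
    coe_one_ae hone] with ω h1 h2 h3 h4
  rw [h1, h2, h3, h4, mul_one]
  exact abs_max_zero_le_abs _

/-- With t = f - k this is c units of the call spread with strikes k and k + 1/c. The right-hand
side makes monotonicity in c evident. -/
theorem mul_posPart_sub_posPart {c t : ℝ} (hc : 0 < c) :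
    c * (max t 0 - max (t - c⁻¹) 0) = min 1 (c * max t 0) := by
  have hcc : c * c⁻¹ = 1 := mul_inv_cancel₀ hc.ne'
  have hci : 0 < c⁻¹ := inv_pos.2 hc
  rcases le_total t 0 with h | h
  · rw [max_eq_right h, max_eq_right (by linarith)]
    simp
  rcases le_total t c⁻¹ with h' | h'
  · rw [max_eq_left h, max_eq_right (by linarith), sub_zero, min_eq_right]
    nlinarith
  · rw [max_eq_left h, max_eq_left (by linarith), min_eq_left]
    · linear_combination hcc
    · nlinarith

theorem tendsto_min_one_mul (t : ℝ) :
    Tendsto (fun n : ℕ => min 1 (((n : ℝ) + 1) * max t 0)) atTop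
      (𝓝 ((Set.Ioi (0 : ℝ)).indicator 1 t)) := by
  rcases le_or_gt t 0 with h | h
  · simp [h]
  · have h1 : Tendsto (fun n : ℕ => ((n : ℝ) + 1) * max t 0) atTop atTop :=
      (tendsto_natCast_atTop_atTop.atTop_add tendsto_const_nhds).atTop_mul_const
        (lt_max_of_lt_left h)
    refine tendsto_const_nhds.congr' ?_
    filter_upwards [h1.eventually_ge_atTop 1] with n hn
    simp [h, min_eq_left hn]

variable {θ : X →ₗ[ℝ] ℝ} {f : X}

theorem map_indicator_Ioi_eq_zero (hX : IsIdeal X) (hone : (1 : Ω →ₘ[P] ℝ) ∈ X)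
    (hθ : IsOrderContinuous θ) (hM : ∀ x ∈ optionSpace f, θ x = 0) (k : ℝ) {x : X}
    (hx : ∀ᵐ ω ∂P, (x : Ω →ₘ[P] ℝ) ω =
      (((f : Ω →ₘ[P] ℝ) : Ω → ℝ) ⁻¹' Set.Ioi k).indicator 1 ω) : θ x = 0 := by
  choose y hyM hy using exists_mem_optionSpace hX hone f
  set u : ℕ → X := fun n => ((n : ℝ) + 1) • (y k - y (k + ((n : ℝ) + 1)⁻¹)) with hudef
  have hu : ∀ᵐ ω ∂P, ∀ n : ℕ, (u n : Ω →ₘ[P] ℝ) ω =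
      min 1 (((n : ℝ) + 1) * max ((f : Ω →ₘ[P] ℝ) ω - k) 0) := by
    refine ae_all_iff.2 fun n => ?_
    filter_upwards [coe_smul_ae ((n : ℝ) + 1) (y k - y (k + ((n : ℝ) + 1)⁻¹)),
      coe_sub_ae (y k) (y (k + ((n : ℝ) + 1)⁻¹)), hy k, hy (k + ((n : ℝ) + 1)⁻¹)]
      with ω h1 h2 h3 h4
    rw [h1, h2, h3, h4, ← mul_posPart_sub_posPart (by positivity), sub_sub]
  have hmono : Monotone u := by
    intro m n hmn
    refine le_iff_ae.2 ?_
    filter_upwards [hu] with ω h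
    rw [h, h]
    gcongr
  have ht := hθ.tendsto_of_monotone (a := x) hmono <| by
    filter_upwards [hu, hx] with ω h1 h2
    have h3 := tendsto_min_one_mul ((f : Ω →ₘ[P] ℝ) ω - k)
    simp only [h1, h2]
    convert h3 using 2
    simp [Set.indicator]
  refine tendsto_nhds_unique ht (tendsto_const_nhds.congr fun n => ?_)
  exact (hM _ (Submodule.smul_mem _ _ (Submodule.sub_mem _ (hyM _) (hyM _)))).symm

/-- The half-lines (k, ∞) form a π-system that generates the Borel sets. Complements are handled by
the constant 1 in the option space, disjoint unions by order continuity along partial sums. -/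
theorem map_indicator_preimage_eq_zero (hX : IsIdeal X) (hone : (1 : Ω →ₘ[P] ℝ) ∈ X)
    (hθ : IsOrderContinuous θ) (hM : ∀ x ∈ optionSpace f, θ x = 0) {B : Set ℝ}
    (hB : MeasurableSet B) : ∀ x : X, (∀ᵐ ω ∂P, (x : Ω →ₘ[P] ℝ) ω =
      (((f : Ω →ₘ[P] ℝ) : Ω → ℝ) ⁻¹' B).indicator 1 ω) → θ x = 0 := by
  have hfm : Measurable ((f : Ω →ₘ[P] ℝ) : Ω → ℝ) := AEEqFun.measurable _
  induction B, hB using MeasurableSpace.induction_on_inter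
    ((BorelSpace.measurable_eq (α := ℝ)).trans (borel_eq_generateFrom_Ioi ℝ)) isPiSystem_Ioi with
  | empty =>
    intro x hx
    rw [ext_ae (x := x) (y := 0), map_zero]
    filter_upwards [hx, coe_zero_ae (X := X)] with ω h1 h2
    rw [h1, h2]
    simp
  | basic B hB =>
    obtain ⟨k, rfl⟩ := hB
    exact fun x hx => map_indicator_Ioi_eq_zero hX hone hθ hM k hx
  | compl B hB ih =>
    intro x hx
    have h1 := hM _ (one_mem_optionSpace hone f)
    have h2 := ih (⟨1, hone⟩ - x) <| by
      filter_upwards [hx, coe_sub_ae ⟨1, hone⟩ x, coe_one_ae hone] with ω h1 h2 h3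
      rw [h2, h1, h3]
      by_cases h : (f : Ω →ₘ[P] ℝ) ω ∈ B <;> simp [h]
    rw [map_sub, h1] at h2
    linarith
  | iUnion s hd hs ih =>
    intro x hx
    choose y hy using fun n => hX.exists_indicator hone (hfm (hs n))
    have hy' := ae_all_iff.2 hy
    have hsum : ∀ᵐ ω ∂P, ∀ n, ((∑ i ∈ Finset.range n, y i : X) : Ω →ₘ[P] ℝ) ω =
        ∑ i ∈ Finset.range n, (((f : Ω →ₘ[P] ℝ) : Ω → ℝ) ⁻¹' s i).indicator (1 : Ω → ℝ) ω := by
      refine ae_all_iff.2 fun n => ?_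
      induction n with
      | zero =>
        filter_upwards [coe_zero_ae (X := X)] with ω h
        simpa using h
      | succ n ihn =>
        filter_upwards [ihn, hy', coe_add_ae (∑ i ∈ Finset.range n, y i) (y n)] with ω h1 h2 h3
        rw [Finset.sum_range_succ, Finset.sum_range_succ, h3, h1, h2]
    have ht := hθ.tendsto_of_monotone (u := fun n => ∑ i ∈ Finset.range n, y i) (a := x) ?_ ?_
    · refine tendsto_nhds_unique ht (tendsto_const_nhds.congr fun n => ?_)
      rw [map_sum, Finset.sum_eq_zero fun i _ => ih i (y i) (hy i)]
    · refine monotone_nat_of_le_succ fun n => le_iff_ae.2 ?_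
      filter_upwards [hsum] with ω h
      rw [h, h, Finset.sum_range_succ]
      exact le_add_of_nonneg_right (Set.indicator_nonneg (fun _ _ => zero_le_one) _)
    · filter_upwards [hsum, hx] with ω h1 h2
      simp only [h1, h2, Set.preimage_iUnion]
      refine HasSum.tendsto_sum_nat (f := fun i =>
        (((f : Ω →ₘ[P] ℝ) : Ω → ℝ) ⁻¹' s i).indicator (1 : Ω → ℝ) ω) ?_
      by_cases h : ∃ i, (f : Ω →ₘ[P] ℝ) ω ∈ s i
      · obtain ⟨i, hi⟩ := h
        have h3 : (((f : Ω →ₘ[P] ℝ) : Ω → ℝ) ⁻¹' s i).indicator (1 : Ω → ℝ) ω = 1 :=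
          Set.indicator_of_mem (s := ((f : Ω →ₘ[P] ℝ) : Ω → ℝ) ⁻¹' s i) hi _
        rw [Set.indicator_of_mem (show ω ∈ ⋃ i, ((f : Ω →ₘ[P] ℝ) : Ω → ℝ) ⁻¹' s i from
          Set.mem_iUnion.2 ⟨i, hi⟩), Pi.one_apply, ← h3]
        exact hasSum_single i fun j hj => Set.indicator_of_notMem
          (s := ((f : Ω →ₘ[P] ℝ) : Ω → ℝ) ⁻¹' s j)
          (fun hj' => Set.disjoint_left.1 (hd hj) hj' hi) _
      · push Not at h
        rw [Set.indicator_of_notMem (by simpa using h)]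
        refine hasSum_zero.congr_fun fun i => ?_
        exact Set.indicator_of_notMem (s := ((f : Ω →ₘ[P] ℝ) : Ω → ℝ) ⁻¹' s i) (h i) _

/-- The `σ`-algebra of the measurable sets that agree a.e. with a preimage of a Borel set. -/
@[reducible] def aePreimage (f : Ω →ₘ[P] ℝ) : MeasurableSpace Ω where
  MeasurableSet' A := MeasurableSet A ∧
    ∃ B : Set ℝ, MeasurableSet B ∧ A =ᵐ[P] (f : Ω → ℝ) ⁻¹' B
  measurableSet_empty := ⟨.empty, ∅, .empty, by simp⟩
  measurableSet_compl A := fun ⟨hA, B, hB, h⟩ => ⟨hA.compl, Bᶜ, hB.compl, h.compl⟩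
  measurableSet_iUnion s hs := by
    choose h1 B hB h using hs
    refine ⟨.iUnion h1, ⋃ n, B n, .iUnion hB, ?_⟩
    rw [Set.preimage_iUnion]
    exact Filter.EventuallyEq.countable_iUnion h

/-- Both kinds of generators of `sigmaAlgebra f` lie in `aePreimage f`: preimages trivially, and
null sets because they agree a.e. with the preimage of ∅. -/
theorem exists_preimage_ae_eq (f : Ω →ₘ[P] ℝ) {A : Set Ω} (hA : MeasurableSet[sigmaAlgebra f] A) :
    MeasurableSet A ∧ ∃ B : Set ℝ, MeasurableSet B ∧ A =ᵐ[P] (f : Ω → ℝ) ⁻¹' B := by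
  have hle : sigmaAlgebra f ≤ aePreimage f := by
    refine sup_le ?_ (MeasurableSpace.generateFrom_le ?_)
    · rintro _ ⟨B, hB, rfl⟩
      exact ⟨AEEqFun.measurable f hB, B, hB, .rfl⟩
    · rintro A ⟨hA, h0⟩
      exact ⟨hA, ∅, .empty, by simpa using ae_eq_empty.2 h0⟩
  exact hle A hA

theorem map_indicator_eq_zero (hX : IsIdeal X) (hone : (1 : Ω →ₘ[P] ℝ) ∈ X)
    (hθ : IsOrderContinuous θ) (hM : ∀ x ∈ optionSpace f, θ x = 0) {A : Set Ω}
    (hA : MeasurableSet[sigmaAlgebra (f : Ω →ₘ[P] ℝ)] A) {x : X}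
    (hx : ∀ᵐ ω ∂P, (x : Ω →ₘ[P] ℝ) ω = A.indicator 1 ω) : θ x = 0 := by
  obtain ⟨-, B, hB, h⟩ := exists_preimage_ae_eq _ hA
  refine map_indicator_preimage_eq_zero hX hone hθ hM hB x ?_
  filter_upwards [hx, indicator_ae_eq_of_ae_eq_set (f := (1 : Ω → ℝ)) h] with ω h1 h2
  rw [h1, h2]

theorem sigmaAlgebra_le (f : Ω →ₘ[P] ℝ) : sigmaAlgebra f ≤ ‹MeasurableSpace Ω› :=
  fun _ hA => (exists_preimage_ae_eq f hA).1

theorem map_simpleFunc_eq_zero (hX : IsIdeal X) (hone : (1 : Ω →ₘ[P] ℝ) ∈ X)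
    (hθ : IsOrderContinuous θ) (hM : ∀ x ∈ optionSpace f, θ x = 0)
    (s : @SimpleFunc Ω (sigmaAlgebra (f : Ω →ₘ[P] ℝ)) ℝ) :
    ∃ x : X, (∀ᵐ ω ∂P, (x : Ω →ₘ[P] ℝ) ω = s ω) ∧ θ x = 0 := by
  induction s using SimpleFunc.induction with
  | @const c A hA =>
    obtain ⟨x, hx⟩ := hX.exists_indicator hone (sigmaAlgebra_le _ _ hA)
    refine ⟨c • x, ?_, by rw [map_smul, map_indicator_eq_zero hX hone hθ hM hA hx, smul_zero]⟩
    filter_upwards [hx, coe_smul_ae c x] with ω h1 h2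
    rw [h2, h1]
    by_cases h : ω ∈ A <;> simp [h]
  | add _ ih1 ih2 =>
    obtain ⟨x, hx, hx0⟩ := ih1
    obtain ⟨y, hy, hy0⟩ := ih2
    refine ⟨x + y, ?_, by rw [map_add, hx0, hy0, add_zero]⟩
    filter_upwards [hx, hy, coe_add_ae x y] with ω h1 h2 h3
    rw [h3, h1, h2]
    rfl

theorem exists_monotone_simpleFunc_tendsto {α : Type*} [MeasurableSpace α] {h : α → ℝ}
    (hh : Measurable h) (h0 : ∀ a, 0 ≤ h a) :
    ∃ s : ℕ → SimpleFunc α ℝ, (∀ a, Monotone fun n => s n a) ∧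
      ∀ a, Tendsto (fun n => s n a) atTop (𝓝 (h a)) := by
  set F : α → ENNReal := fun a => ENNReal.ofReal (h a)
  -- The approximants `eapprox` take only finite values, so `toReal` preserves their monotonicity.
  refine ⟨fun n => (SimpleFunc.eapprox F n).map ENNReal.toReal, fun a m n hmn => ?_, fun a => ?_⟩
  · exact ENNReal.toReal_mono (SimpleFunc.eapprox_lt_top F n a).ne
      (SimpleFunc.monotone_eapprox F hmn a)
  · have h3 := (ENNReal.tendsto_toReal ENNReal.ofReal_ne_top).comp
      (SimpleFunc.tendsto_eapprox (f := F) (ENNReal.measurable_ofReal.comp hh) a)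
    rwa [ENNReal.toReal_ofReal (h0 a)] at h3

theorem map_eq_zero_of_nonneg (hX : IsIdeal X) (hone : (1 : Ω →ₘ[P] ℝ) ∈ X)
    (hθ : IsOrderContinuous θ) (hM : ∀ x ∈ optionSpace f, θ x = 0) {g : X} {h : Ω → ℝ}
    (hh : Measurable[sigmaAlgebra (f : Ω →ₘ[P] ℝ)] h) (h0 : ∀ ω, 0 ≤ h ω)
    (hg : ∀ᵐ ω ∂P, (g : Ω →ₘ[P] ℝ) ω = h ω) : θ g = 0 := by
  obtain ⟨s, hs, hlim⟩ := @exists_monotone_simpleFunc_tendsto Ω (sigmaAlgebra _) h hh h0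
  choose u hu hu0 using fun n => map_simpleFunc_eq_zero hX hone hθ hM (s n)
  have hu' := ae_all_iff.2 hu
  refine tendsto_nhds_unique (hθ.tendsto_of_monotone (u := u) (a := g) ?_ ?_)
    (tendsto_const_nhds.congr fun n => (hu0 n).symm)
  · intro m n hmn
    refine le_iff_ae.2 ?_
    filter_upwards [hu'] with ω h1
    rw [h1, h1]
    exact hs ω hmn
  · filter_upwards [hu', hg] with ω h1 h2
    simp only [h1, h2]
    exact hlim ω

/-- An order continuous functional that vanishes on the option space of `f` vanishes on every
claim written on `f`. -/
theorem map_contingentClaim_eq_zero (hX : IsIdeal X) (hone : (1 : Ω →ₘ[P] ℝ) ∈ X)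
    (hθ : IsOrderContinuous θ) (hM : ∀ x ∈ optionSpace f, θ x = 0) {g : X}
    (hg : IsContingentClaimOn f g) : θ g = 0 := by
  -- Monotone approximation needs a sign, so g is split into g⁺ and g⁻, both in X because they are
  -- dominated by |g|.
  have hmpos : Measurable[sigmaAlgebra (f : Ω →ₘ[P] ℝ)]
      fun ω => max ((g : Ω →ₘ[P] ℝ) ω) 0 := hg.max measurable_const
  have hmneg : Measurable[sigmaAlgebra (f : Ω →ₘ[P] ℝ)]
      fun ω => max (-(g : Ω →ₘ[P] ℝ) ω) 0 := hg.neg.max measurable_const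
  obtain ⟨p, hp⟩ := hX.exists_of_dominated g
    (hmpos.mono (sigmaAlgebra_le _) le_rfl).aestronglyMeasurable
    (ae_of_all _ fun ω => abs_max_zero_le_abs _)
  obtain ⟨q, hq⟩ := hX.exists_of_dominated g
    (hmneg.mono (sigmaAlgebra_le _) le_rfl).aestronglyMeasurable
    (ae_of_all _ fun ω => (abs_max_zero_le_abs _).trans_eq (abs_neg _))
  have hgpq : g = p - q := ext_ae <| by
    filter_upwards [hp, hq, coe_sub_ae p q] with ω h1 h2 h3
    rw [h3, h1, h2]
    rcases le_total 0 ((g : Ω →ₘ[P] ℝ) ω) with h | h <;> simp [h]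
  rw [hgpq, map_sub,
    map_eq_zero_of_nonneg hX hone hθ hM hmpos (fun ω => le_max_right _ _) hp,
    map_eq_zero_of_nonneg hX hone hθ hM hmneg (fun ω => le_max_right _ _) hq, sub_zero]

/-! ### Positive functionals: boundedness and weighted sums -/

theorem map_mono_of_nonneg {φ : X →ₗ[ℝ] ℝ} (hφ : ∀ x : X, 0 ≤ x → 0 ≤ φ x) {x y : X}
    (h : x ≤ y) : φ x ≤ φ y := by
  have := hφ (y - x) (sub_nonneg.2 h)
  rw [map_sub] at this
  linarith

theorem abs_map_le {φ : X →ₗ[ℝ] ℝ} (hφ : ∀ x : X, 0 ≤ x → 0 ≤ φ x) {x y : X}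
    (h : |(x : Ω →ₘ[P] ℝ)| ≤ (y : Ω →ₘ[P] ℝ)) : |φ x| ≤ φ y := by
  have h' := abs_le_iff_ae.1 h
  have h1 : x ≤ y := le_iff_ae.2 <| by
    filter_upwards [h'] with ω h using (abs_le.1 h).2
  have h2 : -y ≤ x := le_iff_ae.2 <| by
    filter_upwards [h', coe_neg_ae y] with ω h h1
    rw [h1]
    exact (abs_le.1 h).1
  refine abs_le.2 ⟨?_, map_mono_of_nonneg hφ h1⟩
  have := map_mono_of_nonneg hφ h2
  rwa [map_neg] at this

variable {N : Seminorm ℝ X}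

/-- The positive cone is closed for a lattice norm. -/
theorem IsCompleteLatticeNorm.le_of_tendsto (hN : IsCompleteLatticeNorm X N) (hX : IsIdeal X)
    {u : ℕ → X} {a y : X} (hu : Tendsto (fun n => N (u n - a)) atTop (𝓝 0))
    (hy : ∀ᶠ n in atTop, y ≤ u n) : y ≤ a := by
  -- Here z = (y - a)⁺. Whenever y ≤ u n, it satisfies |z| ≤ |u n - a|, so N z = 0.
  obtain ⟨z, hz⟩ := hX.exists_of_dominated (y - a)
    (h := fun ω => max (((y - a : X) : Ω →ₘ[P] ℝ) ω) 0)
    ((AEEqFun.measurable _).max measurable_const).aestronglyMeasurable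
    (ae_of_all _ fun ω => abs_max_zero_le_abs _)
  have hz0 : N z ≤ 0 := by
    refine ge_of_tendsto hu ?_
    filter_upwards [hy] with n hn
    refine hN.mono _ _ (abs_le_abs_iff_ae.2 ?_)
    filter_upwards [hz, le_iff_ae.1 hn, coe_sub_ae y a, coe_sub_ae (u n) a] with ω h1 h2 h3 h4
    rw [h1, h3, h4, abs_of_nonneg (le_max_right _ _)]
    refine max_le (le_trans ?_ (le_abs_self _)) (abs_nonneg _)
    linarith
  have := hN.eq_zero z (le_antisymm hz0 (apply_nonneg N z))
  refine le_iff_ae.2 ?_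
  filter_upwards [hz, coe_zero_ae (X := X), coe_sub_ae y a] with ω h1 h2 h3
  rw [this, h2, h3] at h1
  have := h1 ▸ le_max_left _ _
  linarith

/-- A positive functional is bounded for a complete lattice norm. -/
theorem IsCompleteLatticeNorm.exists_bound (hN : IsCompleteLatticeNorm X N) (hX : IsIdeal X)
    {φ : X →ₗ[ℝ] ℝ} (hφ : ∀ x : X, 0 ≤ x → 0 ≤ φ x) :
    ∃ C : ℝ, 0 ≤ C ∧ ∀ x : X, |φ x| ≤ C * N x := by
  suffices h : ∃ C : ℝ, 0 ≤ C ∧ ∀ x : X, 0 ≤ x → φ x ≤ C * N x by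
    obtain ⟨C, hC, h⟩ := h
    refine ⟨C, hC, fun x => ?_⟩
    obtain ⟨y, hy⟩ := hX.exists_of_dominated x (h := fun ω => |(x : Ω →ₘ[P] ℝ) ω|)
      (AEEqFun.measurable _).abs.aestronglyMeasurable (ae_of_all _ fun ω => (abs_abs _).le)
    have hy0 : 0 ≤ y := nonneg_iff_ae.2 <| by
      filter_upwards [hy] with ω h
      rw [h]
      exact abs_nonneg _
    calc |φ x| ≤ φ y := abs_map_le hφ <| abs_le_iff_ae.2 <| by
          filter_upwards [hy] with ω h using h.ge
      _ ≤ C * N y := h y hy0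
      _ ≤ C * N x := mul_le_mul_of_nonneg_left (hN.mono _ _ <| abs_le_abs_iff_ae.2 <| by
          filter_upwards [hy] with ω h
          rw [h, abs_abs]) hC
  by_contra! hcon
  -- The factor 4ⁿ = 2ⁿ · 2ⁿ is shared out: rescaling x n to norm 2⁻ⁿ makes the series converge and
  -- still leaves φ (z n) ≥ 2ⁿ. The limit a dominates every z n, so φ a would exceed every 2ⁿ.
  choose x hx0 hx using fun n : ℕ => hcon (4 ^ n) (by positivity)
  have hNx : ∀ n, 0 < N (x n) := fun n => by
    refine lt_of_le_of_ne (apply_nonneg N _) fun h => ?_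
    have h0 := hN.eq_zero _ h.symm
    have := hx n
    rw [h0] at this
    simp at this
  set z : ℕ → X := fun n => ((2 ^ n)⁻¹ * (N (x n))⁻¹) • x n with hzdef
  have hNz : ∀ n, N (z n) = (1 / 2) ^ n := fun n => by
    rw [hzdef]
    simp only
    rw [map_smul_eq_mul, Real.norm_of_nonneg (by have := hNx n; positivity), mul_assoc,
      inv_mul_cancel₀ (hNx n).ne', mul_one, one_div, inv_pow]
  have hφz : ∀ n, 2 ^ n ≤ φ (z n) := fun n => by
    have h1 := hNx n
    have h2 : (4 : ℝ) ^ n = 2 ^ n * 2 ^ n := by rw [← mul_pow]; norm_num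
    rw [hzdef]
    simp only
    rw [map_smul, smul_eq_mul, ← mul_inv, ← div_eq_inv_mul, le_div_iff₀ (by positivity)]
    have := (hx n).le
    rw [h2] at this
    linarith
  have hz0 : ∀ n, 0 ≤ z n := fun n => nonneg_iff_ae.2 <| by
    filter_upwards [nonneg_iff_ae.1 (hx0 n), coe_smul_ae ((2 ^ n)⁻¹ * (N (x n))⁻¹) (x n)]
      with ω h1 h2
    rw [h2]
    have := hNx n
    positivity
  set u : ℕ → X := fun n => ∑ i ∈ Finset.range n, z i with hudef
  have humono : Monotone u := monotone_nat_of_le_succ fun n => by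
    simp only [hudef, Finset.sum_range_succ]
    exact le_add_of_nonneg_right (hz0 n)
  have hsub : ∀ n m, n ≤ m → N (u m - u n) ≤
      |∑ i ∈ Finset.range m, (1 / 2 : ℝ) ^ i - ∑ i ∈ Finset.range n, (1 / 2 : ℝ) ^ i| := by
    intro n m hnm
    rw [hudef]
    simp only
    rw [← Finset.sum_Ico_eq_sub _ hnm, ← Finset.sum_Ico_eq_sub _ hnm]
    refine le_trans ?_ (le_abs_self _)
    refine (Finset.le_sum_of_subadditive N (map_zero N).le (map_add_le_add N) _ _).trans ?_
    exact Finset.sum_le_sum fun i _ => (hNz i).le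
  have hcauchy := (summable_geometric_two.hasSum.tendsto_sum_nat).cauchySeq
  obtain ⟨a, ha⟩ := hN.complete u fun ε hε => by
    obtain ⟨n₀, hn₀⟩ := Metric.cauchySeq_iff.1 hcauchy ε hε
    refine ⟨n₀, fun m hm n hn => ?_⟩
    rcases le_total n m with h | h
    · exact (hsub n m h).trans_lt (hn₀ m hm n hn)
    · rw [map_sub_rev]
      exact (hsub m n h).trans_lt (hn₀ n hn m hm)
  have hle : ∀ n, u n ≤ a := fun n => hN.le_of_tendsto hX ha <| by
    filter_upwards [eventually_ge_atTop n] with m hm using humono hm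
  obtain ⟨n, hn⟩ := pow_unbounded_of_one_lt (φ a) (one_lt_two (α := ℝ))
  have h1 : z n ≤ u (n + 1) :=
    Finset.single_le_sum (f := z) (fun i _ => hz0 i) (Finset.self_mem_range_succ n)
  exact absurd ((hφz n).trans (map_mono_of_nonneg hφ (h1.trans (hle _)))) hn.not_ge

/-- Up to positive weights, positive order continuous functionals can be summed. -/
theorem exists_hasSum_orderContinuous (hN : IsCompleteLatticeNorm X N) (hX : IsIdeal X)
    {φ : ℕ → X →ₗ[ℝ] ℝ} (hφ : ∀ n, ∀ x : X, 0 ≤ x → 0 ≤ φ n x)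
    (hoc : ∀ n, IsOrderContinuous (φ n)) :
    ∃ (c : ℕ → ℝ) (Φ : X →ₗ[ℝ] ℝ), (∀ n, 0 < c n) ∧
      (∀ x, HasSum (fun n => c n * φ n x) (Φ x)) ∧ IsOrderContinuous Φ := by
  choose C hC hbound using fun n => hN.exists_bound hX (hφ n)
  -- These weights give |c n * φ n x| ≤ 2⁻ⁿ N x; the summand 1 avoids division by zero.
  set c : ℕ → ℝ := fun n => (1 / 2) ^ n * (1 + C n)⁻¹ with hcdef
  have hc : ∀ n, 0 < c n := fun n => by
    have := hC n
    positivity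
  have hsum : ∀ x, Summable fun n => c n * φ n x := fun x => by
    refine Summable.of_norm_bounded (summable_geometric_two.mul_right (N x)) fun n => ?_
    have h1 : 0 < 1 + C n := by have := hC n; positivity
    rw [norm_mul, Real.norm_of_nonneg (hc n).le, Real.norm_eq_abs, hcdef]
    simp only
    rw [mul_assoc]
    refine mul_le_mul_of_nonneg_left ?_ (by positivity)
    rw [inv_mul_le_iff₀ h1]
    have h2 := hbound n x
    have h3 := apply_nonneg N x
    linarith
  let Φ : X →ₗ[ℝ] ℝ :=
    { toFun := fun x => ∑' n, c n * φ n x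
      map_add' := fun x y => by
        rw [← (hsum x).tsum_add (hsum y)]
        exact tsum_congr fun n => by rw [map_add, mul_add]
      map_smul' := fun r x => by
        rw [RingHom.id_apply, smul_eq_mul, ← tsum_mul_left]
        exact tsum_congr fun n => by rw [map_smul, smul_eq_mul]; ring }
  have hΦ : ∀ x, HasSum (fun n => c n * φ n x) (Φ x) := fun x => (hsum x).hasSum
  have hΦ0 : ∀ x : X, 0 ≤ x → 0 ≤ Φ x := fun x hx =>
    (hΦ x).nonneg fun n => mul_nonneg (hc n).le (hφ n x hx)
  refine ⟨c, Φ, hc, hΦ, (isOrderContinuous_iff Φ).2 fun D hD ε hε => ?_⟩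
  obtain ⟨d₀, hd₀⟩ := hD.1
  obtain ⟨K, hK⟩ := Metric.tendsto_atTop.1 (hΦ d₀).tendsto_sum_nat (ε / 2) (by positivity)
  -- The finite part Ψ is order continuous. The tail Φ - Ψ is positive and below ε/2 at d₀, hence
  -- below ε/2 at every d ≤ d₀.
  set Ψ : X →ₗ[ℝ] ℝ := ∑ n ∈ Finset.range K, c n • φ n with hΨdef
  have hΨapply : ∀ x, Ψ x = ∑ n ∈ Finset.range K, c n * φ n x := fun x => by simp [hΨdef]
  have hΨ : Ψ ∈ orderContinuousDual X :=
    Submodule.sum_mem _ fun n _ => Submodule.smul_mem _ _ (hoc n)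
  have htail : ∀ x : X, 0 ≤ x → 0 ≤ (Φ - Ψ) x := fun x hx => by
    rw [LinearMap.sub_apply, hΨapply, sub_nonneg]
    exact sum_le_hasSum _ (fun n _ => mul_nonneg (hc n).le (hφ n x hx)) (hΦ x)
  obtain ⟨d₁, hd₁, h1⟩ := (isOrderContinuous_iff Ψ).1 hΨ D hD (ε / 2) (by positivity)
  obtain ⟨d, hd, hdd₀, hdd₁⟩ := hD.2.1 d₀ hd₀ d₁ hd₁
  refine ⟨d, hd, fun x hx => (abs_map_le hΦ0 hx).trans_lt ?_⟩
  have h2 := h1 d (abs_le_iff_ae.2 <| by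
    filter_upwards [le_iff_ae.1 hdd₁, nonneg_iff_ae.1 (hD.2.2.1 hd)] with ω h1 h2
    rwa [abs_of_nonneg h2])
  have h3 := map_mono_of_nonneg htail hdd₀
  have h4 := hK K le_rfl
  rw [← hΨapply, Real.dist_eq] at h4
  rw [LinearMap.sub_apply, LinearMap.sub_apply] at h3
  have h5 := neg_abs_le (Ψ d₀ - Φ d₀)
  have h6 := le_abs_self (Ψ d)
  linarith

/-! ### Exhaustion and carriers -/

/-- A family of measurable sets which is closed under countable unions has a largest element up to
null sets. -/
theorem exists_ae_largest [IsFiniteMeasure P] {S : Set (Set Ω)} (hne : S.Nonempty)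
    (hm : ∀ A ∈ S, MeasurableSet A) (hU : ∀ s : ℕ → Set Ω, (∀ n, s n ∈ S) → (⋃ n, s n) ∈ S) :
    ∃ A ∈ S, ∀ B ∈ S, P (B \ A) = 0 := by
  -- The union of a maximizing sequence attains the supremum of the measures, so adjoining B cannot
  -- increase its measure.
  obtain ⟨u, -, hu, huS⟩ := exists_seq_tendsto_sSup (S := P '' S) (hne.image _)
    (OrderTop.bddAbove _)
  choose s hs hsu using huS
  have hA := hU s hs
  refine ⟨_, hA, fun B hB => ?_⟩
  have hAB : (⋃ n, s n) ∪ B ∈ S := by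
    have := hU (fun n => Nat.casesOn n B s) (fun n => by cases n <;> simp [hB, hs])
    convert this using 1
    ext ω
    simp only [Set.mem_union, Set.mem_iUnion]
    constructor
    · rintro (⟨n, hn⟩ | h)
      · exact ⟨n + 1, hn⟩
      · exact ⟨0, h⟩
    · rintro ⟨n, hn⟩
      cases n with
      | zero => exact Or.inr hn
      | succ n => exact Or.inl ⟨n, hn⟩
  have h1 : P ((⋃ n, s n) ∪ B) ≤ P (⋃ n, s n) := by
    refine (le_sSup (Set.mem_image_of_mem P hAB)).trans (le_of_tendsto' hu fun n => ?_)
    rw [← hsu]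
    exact measure_mono (Set.subset_iUnion s n)
  rw [← Set.union_sdiff_self, measure_union Set.disjoint_sdiff_right ((hm B hB).diff (hm _ hA))]
    at h1
  exact le_zero_iff.1 ((ENNReal.add_le_add_iff_left (measure_ne_top P _)).1 (by simpa using h1))

/-- `φ` is strictly positive on the functions that do not vanish a.e. on `A`. -/
def StrictlyPositiveOn (φ : X →ₗ[ℝ] ℝ) (A : Set Ω) : Prop :=
  ∀ x : X, 0 ≤ x → φ x = 0 → ∀ᵐ ω ∂P, ω ∈ A → (x : Ω →ₘ[P] ℝ) ω = 0

/-- A positive order continuous functional has a carrier. -/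
theorem exists_strictlyPositiveOn_compl [IsFiniteMeasure P] (hX : IsIdeal X)
    (hone : (1 : Ω →ₘ[P] ℝ) ∈ X) {ψ : X →ₗ[ℝ] ℝ} (hψ : ∀ x : X, 0 ≤ x → 0 ≤ ψ x)
    (hoc : IsOrderContinuous ψ) :
    ∃ A : Set Ω, MeasurableSet A ∧ StrictlyPositiveOn ψ Aᶜ ∧
      ∀ x : X, (∀ᵐ ω ∂P, (x : Ω →ₘ[P] ℝ) ω = A.indicator 1 ω) → ψ x = 0 := by
  have hunion : ∀ A B : Set Ω, MeasurableSet A → MeasurableSet B →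
      (∀ x : X, (∀ᵐ ω ∂P, (x : Ω →ₘ[P] ℝ) ω = A.indicator 1 ω) → ψ x = 0) →
      (∀ x : X, (∀ᵐ ω ∂P, (x : Ω →ₘ[P] ℝ) ω = B.indicator 1 ω) → ψ x = 0) →
      ∀ x : X, (∀ᵐ ω ∂P, (x : Ω →ₘ[P] ℝ) ω = (A ∪ B).indicator 1 ω) → ψ x = 0 := by
    intro A B hA hB hA0 hB0 x hx
    obtain ⟨y, hy⟩ := hX.exists_indicator hone hA
    obtain ⟨z, hz⟩ := hX.exists_indicator hone hB
    have h0 : 0 ≤ x := nonneg_iff_ae.2 <| by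
      filter_upwards [hx] with ω h
      rw [h]
      exact Set.indicator_nonneg (fun _ _ => zero_le_one) _
    have h1 : x ≤ y + z := le_iff_ae.2 <| by
      filter_upwards [hx, hy, hz, coe_add_ae y z] with ω h1 h2 h3 h4
      rw [h4, h1, h2, h3]
      by_cases hA : ω ∈ A <;> by_cases hB : ω ∈ B <;> simp [hA, hB]
    have h2 := map_mono_of_nonneg hψ h1
    rw [map_add, hA0 y hy, hB0 z hz, add_zero] at h2
    exact le_antisymm h2 (hψ x h0)
  -- A is the largest set whose indicator ψ annihilates. For countable unions, the accumulated
  -- finite unions supply the increasing sequence that order continuity requires.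
  obtain ⟨A, ⟨hAm, hA0⟩, hA⟩ := exists_ae_largest (P := P)
    (S := {A : Set Ω | MeasurableSet A ∧
      ∀ x : X, (∀ᵐ ω ∂P, (x : Ω →ₘ[P] ℝ) ω = A.indicator 1 ω) → ψ x = 0})
    ⟨∅, .empty, fun x hx => by
      rw [ext_ae (x := x) (y := 0), map_zero]
      filter_upwards [hx, coe_zero_ae (X := X)] with ω h1 h2
      rw [h1, h2]
      simp⟩
    (fun A hA => hA.1) fun s hs => by
      have hacc : ∀ n, MeasurableSet (Set.accumulate s n) ∧ ∀ x : X,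
          (∀ᵐ ω ∂P, (x : Ω →ₘ[P] ℝ) ω = (Set.accumulate s n).indicator 1 ω) → ψ x = 0 := by
        intro n
        induction n with
        | zero => simpa [Set.accumulate_zero_nat] using hs 0
        | succ n ih =>
          rw [Set.accumulate_succ]
          exact ⟨ih.1.union (hs _).1, hunion _ _ ih.1 (hs _).1 ih.2 (hs _).2⟩
      refine ⟨.iUnion fun n => (hs n).1, fun x hx => ?_⟩
      choose y hy using fun n => hX.exists_indicator hone (hacc n).1
      have hy' := ae_all_iff.2 hy
      refine tendsto_nhds_unique (hoc.tendsto_of_monotone (u := y) (a := x) ?_ ?_)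
        (tendsto_const_nhds.congr fun n => ((hacc n).2 _ (hy n)).symm)
      · intro m n hmn
        refine le_iff_ae.2 ?_
        filter_upwards [hy'] with ω h
        rw [h, h]
        exact Set.indicator_le_indicator_of_subset (Set.monotone_accumulate hmn)
          (fun _ => zero_le_one) _
      · filter_upwards [hy', hx] with ω h1 h2
        simp only [h1, h2, ← Set.iUnion_accumulate (s := s)]
        exact (Set.monotone_accumulate.tendsto_indicator _ _ _).mono_right (pure_le_nhds _)
  refine ⟨A, hAm, fun x hx hx0 => ?_, hA0⟩
  have hxm : Measurable ((x : Ω →ₘ[P] ℝ) : Ω → ℝ) := AEEqFun.measurable _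
  -- If ψ x = 0, then ψ annihilates the indicator of {x > 0}, the increasing limit of min(1, (n + 1)
  -- x⁺) ≤ (n + 1) x. Hence {x > 0} lies in A up to a null set.
  have hnull := hA (((x : Ω →ₘ[P] ℝ) : Ω → ℝ) ⁻¹' Set.Ioi 0) ⟨hxm measurableSet_Ioi, by
    intro b hb
    choose y hy using fun n : ℕ => hX.exists_of_bounded hone (C := 1)
      (h := fun ω => min 1 (((n : ℝ) + 1) * max ((x : Ω →ₘ[P] ℝ) ω) 0))
      (measurable_const.min ((hxm.max measurable_const).const_mul _)).aestronglyMeasurable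
      (ae_of_all _ fun ω => by
        rw [abs_of_nonneg (by positivity)]
        exact min_le_left _ _)
    have hy' := ae_all_iff.2 hy
    refine tendsto_nhds_unique (hoc.tendsto_of_monotone (u := y) (a := b) ?_ ?_)
      (tendsto_const_nhds.congr fun n => ?_)
    · intro m n hmn
      refine le_iff_ae.2 ?_
      filter_upwards [hy'] with ω h
      rw [h, h]
      gcongr
    · filter_upwards [hy', hb] with ω h1 h2
      simp only [h1, h2]
      exact tendsto_min_one_mul _
    · refine le_antisymm (hψ _ (nonneg_iff_ae.2 ?_)) ?_
      · filter_upwards [hy n] with ω h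
        rw [h]
        positivity
      · have : y n ≤ ((n : ℝ) + 1) • x := le_iff_ae.2 <| by
          filter_upwards [hy n, coe_smul_ae ((n : ℝ) + 1) x, nonneg_iff_ae.1 hx] with ω h1 h2 h3
          rw [h1, h2, max_eq_left h3]
          exact min_le_right _ _
        have := map_mono_of_nonneg hψ this
        rwa [map_smul, hx0, smul_zero] at this⟩
  filter_upwards [measure_eq_zero_iff_ae_notMem.1 hnull, nonneg_iff_ae.1 hx] with ω h1 h2 h3
  by_contra hne
  exact h1 ⟨lt_of_le_of_ne h2 (Ne.symm hne), h3⟩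

/-! ### The Kreps-Yan theorem and the extension of π -/

/-- The positive order continuous functionals that vanish on the kernel of `π`. -/
def nullPricingFunctionals (M : Submodule ℝ X) (π : M →ₗ[ℝ] ℝ) : Set (X →ₗ[ℝ] ℝ) :=
  {φ | IsOrderContinuous φ ∧ (∀ x : X, 0 ≤ x → 0 ≤ φ x) ∧ ∀ m : M, π m = 0 → φ (m : X) = 0}

variable {M : Submodule ℝ X} {π : M →ₗ[ℝ] ℝ}

/-- Separation of a point from a closed convex set in a weak topology. -/
theorem exists_separating {E F : Type*} [AddCommGroup E] [Module ℝ E] [AddCommGroup F]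
    [Module ℝ F] (B : E →ₗ[ℝ] F →ₗ[ℝ] ℝ) {C : Set (WeakBilin B)} (hC : Convex ℝ C)
    {x : WeakBilin B} (hx : x ∉ closure C) :
    ∃ (y : F) (u : ℝ), (∀ z ∈ C, B z y < u) ∧ u < B x y := by
  obtain ⟨F, u, hFu, hux⟩ := geometric_hahn_banach_closed_point hC.closure isClosed_closure hx
  obtain ⟨y, rfl⟩ := LinearMap.dualEmbedding_surjective B F
  exact ⟨y, u, fun z hz => hFu z (subset_closure hz), hux⟩

theorem exists_orderContinuous_separating {C : Set X} (hC : Convex ℝ C) {x : X}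
    (hx : x ∉ closure[sigmaTopology X] C) :
    ∃ φ ∈ orderContinuousDual X, ∃ u : ℝ, (∀ z ∈ C, φ z < u) ∧ u < φ x := by
  have h := @exists_separating X (orderContinuousDual X) _ _ (Submodule.addCommGroup _)
    (Submodule.module _)
  obtain ⟨φ, u, hφ⟩ := h (pairing X) hC hx
  exact ⟨φ, φ.2, u, hφ⟩

/-- Separation step of the Kreps-Yan theorem. -/
theorem NoFreeLunch.exists_map_pos (h : NoFreeLunch M π) {x : X} (hx : 0 < x) :
    ∃ φ ∈ nullPricingFunctionals M π, 0 < φ x := by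
  set C : Set X := {z : X | ∃ m : M, π m = 0 ∧ ∃ y : X, 0 ≤ y ∧ z = (m : X) - y}
  have hxC : x ∉ closure[sigmaTopology X] C := fun hmem => by
    have h1 : x ∈ ({0} : Set X) := h ▸ ⟨hmem, hx.le⟩
    exact hx.ne' h1
  have hconv : Convex ℝ C := by
    rintro _ ⟨m, hm, y, hy, rfl⟩ _ ⟨m', hm', y', hy', rfl⟩ a b ha hb -
    refine ⟨a • m + b • m', by simp [hm, hm'], a • y + b • y', ?_, ?_⟩
    · refine nonneg_iff_ae.2 ?_
      filter_upwards [coe_add_ae (a • y) (b • y'), coe_smul_ae a y, coe_smul_ae b y',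
        nonneg_iff_ae.1 hy, nonneg_iff_ae.1 hy'] with ω h1 h2 h3 h4 h5
      rw [h1, h2, h3]
      positivity
    · push_cast
      module
  obtain ⟨φ, hφ, u, hφu, hux⟩ := exists_orderContinuous_separating hconv hxC
  have hle : ∀ m : M, π m = 0 → ∀ y : X, 0 ≤ y → φ ((m : X) - y) < u :=
    fun m hm y hy => hφu _ ⟨m, hm, y, hy, rfl⟩
  have hu : 0 < u := by simpa using hle 0 (map_zero π) 0 le_rfl
  refine ⟨φ, ⟨hφ, fun y hy => ?_, fun m hm => ?_⟩, hu.trans hux⟩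
  · by_contra! hneg
    -- The scalar is chosen so that -(u / -φ y) • y, an element of C, has φ-value exactly u, against
    -- the strict bound. The same rescaling of m in the kernel of π shows φ m = 0.
    have hy' : 0 ≤ (u / -φ y) • y := nonneg_iff_ae.2 <| by
      filter_upwards [coe_smul_ae (u / -φ y) y, nonneg_iff_ae.1 hy] with ω h1 h2
      rw [h1]
      exact mul_nonneg (div_nonneg hu.le (by linarith)) h2
    have h1 := hle 0 (map_zero π) _ hy'
    rw [Submodule.coe_zero, zero_sub, map_neg, map_smul, smul_eq_mul, div_neg, neg_mul, neg_neg,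
      div_mul_cancel₀ _ hneg.ne] at h1
    exact h1.false
  · by_contra hne
    have h1 := hle ((u / φ m) • m) (by rw [map_smul, hm, smul_zero]) 0 le_rfl
    rw [sub_zero, Submodule.coe_smul, map_smul, smul_eq_mul, div_mul_cancel₀ _ hne] at h1
    exact h1.false

/-- The Kreps-Yan theorem: in the absence of free lunches there is a strictly positive order
continuous functional that vanishes on the kernel of `π`. -/
theorem NoFreeLunch.exists_strictlyPositive [IsFiniteMeasure P] (h : NoFreeLunch M π)
    (hN : IsCompleteLatticeNorm X N) (hX : IsIdeal X) (hone : (1 : Ω →ₘ[P] ℝ) ∈ X) :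
    ∃ φ ∈ nullPricingFunctionals M π, ∀ x : X, 0 < x → 0 < φ x := by
  obtain ⟨A, ⟨hAm, φ, hφ, hφA⟩, hA⟩ := exists_ae_largest (P := P)
    (S := {A : Set Ω | MeasurableSet A ∧
      ∃ φ ∈ nullPricingFunctionals M π, StrictlyPositiveOn φ A})
    ⟨∅, .empty, 0, ⟨(orderContinuousDual X).zero_mem, by simp, by simp⟩,
      fun x _ _ => by simp⟩
    (fun A hA => hA.1) fun s hs => by
      choose hm φ hφ hφs using hs
      obtain ⟨c, Φ, hc, hΦ, hoc⟩ := exists_hasSum_orderContinuous hN hX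
        (fun n => (hφ n).2.1) (fun n => (hφ n).1)
      refine ⟨.iUnion hm, Φ, ⟨hoc, fun x hx => (hΦ x).nonneg fun n =>
        mul_nonneg (hc n).le ((hφ n).2.1 x hx), fun m hm => ?_⟩, fun x hx hx0 => ?_⟩
      · refine (hΦ m).unique ?_
        simp [(hφ _).2.2 m hm, hasSum_zero]
      · have h1 := hΦ x
        rw [hx0, hasSum_zero_iff_of_nonneg fun n =>
          mul_nonneg (hc n).le ((hφ n).2.1 x hx)] at h1
        have h2 : ∀ n, φ n x = 0 := fun n =>
          (mul_eq_zero.1 (congrFun h1 n)).resolve_left (hc n).ne'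
        have h3 := ae_all_iff.2 fun n => hφs n x hx (h2 n)
        filter_upwards [h3] with ω h hω
        obtain ⟨n, hn⟩ := Set.mem_iUnion.1 hω
        exact h n hn
  have hfull : ∀ᵐ ω ∂P, ω ∈ A := by
    obtain ⟨a, ha⟩ := hX.exists_indicator hone hAm.compl
    have ha0 : 0 ≤ a := nonneg_iff_ae.2 <| by
      filter_upwards [ha] with ω h
      rw [h]
      exact Set.indicator_nonneg (fun _ _ => zero_le_one) _
    rcases ha0.eq_or_lt with h0 | h0
    · filter_upwards [ha, coe_zero_ae (X := X)] with ω h1 h2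
      rw [← h0, h2] at h1
      by_contra hω
      simp [hω] at h1
    · exfalso
      -- The carrier Bᶜ of ψ lies in A a.e. by maximality, so the indicator of Aᶜ is at most that of
      -- B, which ψ annihilates; this contradicts 0 < ψ a.
      obtain ⟨ψ, hψ, hψa⟩ := h.exists_map_pos h0
      obtain ⟨B, hBm, hB, hB0⟩ := exists_strictlyPositiveOn_compl hX hone hψ.2.1 hψ.1
      have hBA := measure_eq_zero_iff_ae_notMem.1 (hA Bᶜ ⟨hBm.compl, ψ, hψ, hB⟩)
      obtain ⟨b, hb⟩ := hX.exists_indicator hone hBm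
      have hab : a ≤ b := le_iff_ae.2 <| by
        filter_upwards [ha, hb, hBA] with ω h1 h2 h3
        rw [h1, h2]
        by_cases hωA : ω ∈ A <;> by_cases hωB : ω ∈ B <;> simp_all
      have := map_mono_of_nonneg hψ.2.1 hab
      rw [hB0 b hb] at this
      exact this.not_gt hψa
  refine ⟨φ, hφ, fun x hx => (hφ.2.1 x hx.le).lt_of_ne fun h0 => hx.ne ?_⟩
  refine ext_ae ?_
  filter_upwards [hφA x hx.le h0.symm, hfull, coe_zero_ae (X := X)] with ω h1 h2 h3
  rw [h3, h1 h2]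

/-- In the absence of free lunches, a positive `π` has a strictly positive order continuous
extension. -/
theorem NoFreeLunch.exists_extension [IsProbabilityMeasure P] (h : NoFreeLunch M π)
    (hN : IsCompleteLatticeNorm X N) (hX : IsIdeal X) (hone : (1 : Ω →ₘ[P] ℝ) ∈ X)
    (hπ : IsPositiveOn M π) (honeM : (⟨1, hone⟩ : X) ∈ M) :
    ∃ φ ∈ orderContinuousDual X, (∀ x : X, 0 < x → 0 < φ x) ∧ ∀ m : M, φ (m : X) = π m := by
  obtain ⟨φ, hφ, hpos⟩ := h.exists_strictlyPositive hN hX hone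
  set e : M := ⟨⟨1, hone⟩, honeM⟩ with he
  have he0 : 0 < (e : X) := by
    refine lt_of_le_of_ne (nonneg_iff_ae.2 ?_) fun h0 => ?_
    · filter_upwards [coe_one_ae hone] with ω h
      rw [h]
      exact zero_le_one
    · have : ∀ᵐ ω ∂P, False := by
        filter_upwards [coe_one_ae hone, coe_zero_ae (X := X)] with ω h1 h2
        rw [h0] at h2
        exact one_ne_zero (h1.symm.trans h2)
      exact this.exists.elim fun _ h => h
  have hφe := hpos _ he0
  -- If π e were 0, then e would lie in the kernel of π and φ e would vanish.
  have hπe : 0 < π e := by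
    refine (hπ e he0.le).lt_of_ne fun h0 => hφe.ne' (hφ.2.2 e h0.symm)
  refine ⟨(π e / φ e) • φ, Submodule.smul_mem _ _ hφ.1, fun x hx => ?_, fun m => ?_⟩
  · exact mul_pos (div_pos hπe hφe) (hpos x hx)
  -- Since φ vanishes on the kernel of π, it is proportional to π on M; comparing values at the
  -- constant 1 gives the ratio.
  · have h0 : π (m + (-(π m / π e)) • e) = 0 := by
      rw [map_add, map_smul, smul_eq_mul, neg_mul, div_mul_cancel₀ _ hπe.ne', add_neg_cancel]
    have h1 := hφ.2.2 _ h0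
    rw [Submodule.coe_add, Submodule.coe_smul, map_add, map_smul, smul_eq_mul, neg_mul,
      ← sub_eq_add_neg, sub_eq_zero] at h1
    rw [LinearMap.smul_apply, h1, smul_eq_mul]
    field_simp

end

end OptionSpanning

/-! ### Existence and uniqueness of the price -/

theorem theorem3p4 {Ω : Type u} [MeasurableSpace Ω] (P : Measure Ω) [IsProbabilityMeasure P]
    (X : Submodule ℝ (Ω →ₘ[P] ℝ)) (hX : OptionSpanning.IsBanachFunctionSpace X)
    (hone : (1 : Ω →ₘ[P] ℝ) ∈ X) (f : X) (hf : 0 ≤ f)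
    (π : OptionSpanning.optionSpace f →ₗ[ℝ] ℝ)
    (hπ : OptionSpanning.IsPositiveOn (OptionSpanning.optionSpace f) π)
    (hNFL : OptionSpanning.NoFreeLunch (OptionSpanning.optionSpace f) π) :
    ∀ g : X, OptionSpanning.IsContingentClaimOn f g →
      OptionSpanning.IsDeterminedByArbitrage (OptionSpanning.optionSpace f) π g := by
  intro g hg
  obtain ⟨hideal, N, hN⟩ := hX
  obtain ⟨φ, hφ, hpos, hext⟩ := hNFL.exists_extension hN hideal hone hπ
    (OptionSpanning.one_mem_optionSpace hone f)
  refine ⟨φ g, ⟨φ, hφ, hpos, hext, rfl⟩, ?_⟩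
  rintro _ ⟨ψ, hψ, -, hψext, rfl⟩
  have := OptionSpanning.map_contingentClaim_eq_zero hideal hone (θ := ψ - φ)
    (Submodule.sub_mem _ hψ hφ) (fun x hx => by
      rw [LinearMap.sub_apply, hψext ⟨x, hx⟩, hext ⟨x, hx⟩, sub_self]) hg
  rwa [LinearMap.sub_apply, sub_eq_zero] at this
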